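/- Let $|\bar\psi_k\rangle=\sin\frac{2k\pi}{3}|0\rangle+\cos\frac{2k\pi}{3}|1\rangle\in\mathbb C^2$ ($k=0,1,2$) be the state orthogonal, in the $X$-$Z$ plane, to the signal state $|\psi_k\rangle=e^{\frac{2k\pi i}{3}\sigma_y}|0\rangle$ of the symmetric three-state (PBC00) protocol, and let $F_Q^{(k)}=\frac23|\bar\psi_k\rangle\langle\bar\psi_k|$ be the qubit target measurement. Let $\mathcal H_N$ be the $(N+1)$-dimensional space of $N$ photons in two polarization modes, and $\mathcal H_M=\bigoplus_{N\ge1}\mathcal H_N$ their Hilbert sum (the vacuum is split off). For $n_0+n_1+n_2=N$ put $$|\bar n_0,\bar n_1,\bar n_2\rangle=\prod_{k}\frac{(\bar a_k^\dagger)^{n_k}}{\sqrt{n_k!}}\,|\mathrm{vac}\rangle\in\mathcal H_N,$$ where $\bar a_k^\dagger$ creates a photon in the state $|\bar\psi_k\rangle$. The threshold-detector (basic) measurement on $\mathcal H_N$ has one outcome for each non-empty set $S\subseteq\{0,1,2\}$ of clicking detectors: for $|S|\le 2$, $$F_{B,N}^{S}=\Bigl(\frac23\Bigr)^N\sum_{\substack{n_0+n_1+n_2=N\\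 \{k:\,n_k>0\}=S}}|\bar n_0,\bar n_1,\bar n_2\rangle\langle\bar n_0,\bar n_1,\bar n_2|,\qquad F_{B,N}^{\{0,1,2\}}=I_N-\sum_{1\le|S|\le2}F_{B,N}^{S}.$$ The full measurement assigns multi-click events uniformly at random to the three outcomes: $$F_{M,N}^{(k)}=F_{B,N}^{\{k\}}+\frac13\sum_{|S|\ge2}F_{B,N}^{S},\qquad F_M^{(k)}=\bigoplus_{N\ge1}F_{M,N}^{(k)} .$$ (a) There is a completely positive, trace-preserving linear map $\Lambda$ from the trace-class operators on $\mathcal H_M$ to the operators on $\mathbb C^2$ such that $$\operatorname{Tr}\bigl(\rho F_M^{(k)}\bigr)=\operatorname{Tr}\bigl(\Lambda(\rho)F_Q^{(k)}\bigr)\qquad\text{for all }\rho\text{ and all }k\in\{0,1,2\}.$$ (b) For every $N\ge1$, let $P_N\subseteq\mathcal H_N$ be the single-click subspace spanned by $|\bar N,\bar0,\bar0\rangle,|\bar0,\bar N,\bar0\rangle,|\bar0,\bar0,\bar N\rangle$, and let $F_{M,P,N}^{(k)}$ be the compression of $F_{M,N}^{(k)}$ to $P_N$. There is a completely positive, trace-preserving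 linear map $\Lambda_{P,N}$ from the operators on $P_N$ to the operators on $\mathbb C^2$ such that $\operatorname{Tr}(\rho F_{M,P,N}^{(k)})=\operatorname{Tr}(\Lambda_{P,N}(\rho)F_Q^{(k)})$ for all operators $\rho$ on $P_N$ and all $k$. -/

import Mathlib

open scoped ComplexOrder

namespace ThreeState

/-! ## Trace-class operators and quantum channels -/

section Channels

variable (H : Type) [NormedAddCommGroup H] [InnerProductSpace ℂ H] [CompleteSpace H]

/-- The vectors of a Hilbert basis of the Hilbert space `H`. -/
noncomputable def basisSet : Set H := Classical.choose (exists_hilbertBasis ℂ H)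

/-- A Hilbert basis of `H`. The trace and the trace class below do not depend on its choice. -/
noncomputable def stdBasis : HilbertBasis (basisSet H) ℂ H :=
  Classical.choose (Classical.choose_spec (exists_hilbertBasis ℂ H))

/-- The trace class of `H`: the linear span of the positive operators with finite trace. -/
noncomputable def traceClass : Submodule ℂ (H →L[ℂ] H) :=
  Submodule.span ℂ {A | A.IsPositive ∧
    Summable fun i => inner ℂ (stdBasis H i) (A (stdBasis H i))}

variable {H}

/-- The trace of an operator (meaningful for trace-class operators). -/
noncomputable def trace (A : H →L[ℂ] H) : ℂ :=
  ∑' i, inner ℂ (stdBasis H i) (A (stdBasis H i))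

/-- The diagonal of a trace-class operator is summable, so that its trace is a genuine sum. -/
theorem summable_of_mem_traceClass {A : H →L[ℂ] H} (hA : A ∈ traceClass H) :
    Summable fun i => inner ℂ (stdBasis H i) (A (stdBasis H i)) := by
  unfold traceClass at hA
  induction hA using Submodule.span_induction with
  | mem x h => exact h.2
  | zero => simp
  | add x y _ _ hx hy => simpa [inner_add_right] using hx.add hy
  | smul a x _ hx => simpa [inner_smul_right] using hx.mul_left a

/-- An `n × n` block matrix of trace-class operators on `H` is positive if it is positive as an
operator on the direct sum of `n` copies of `H`. -/
def BlockPositive {n : ℕ} (X : Matrix (Fin n) (Fin n) (traceClass H)) : Prop :=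
  ∀ v : Fin n → H, 0 ≤ ∑ i, ∑ j, inner ℂ (v i) ((X i j : H →L[ℂ] H) (v j))

variable {K : Type} [NormedAddCommGroup K] [InnerProductSpace ℂ K] [CompleteSpace K]

/-- Completely positive and trace-preserving linear maps between trace classes. -/
structure IsCPTP (Λ : traceClass H →ₗ[ℂ] traceClass K) : Prop where
  completelyPositive : ∀ (n : ℕ) (X : Matrix (Fin n) (Fin n) (traceClass H)),
    BlockPositive X → BlockPositive (X.map Λ)
  tracePreserving : ∀ ρ : traceClass H, trace (Λ ρ : K →L[ℂ] K) = trace (ρ : H →L[ℂ] H)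

/-- The measurement obtained from the measurement `F` by the classical post-processing `P`. -/
noncomputable def postProcess {ι κ : Type} [Fintype ι] (P : Matrix κ ι ℝ) (F : ι → H →L[ℂ] H)
    (k : κ) : H →L[ℂ] H :=
  ∑ s, (P k s : ℂ) • F s

/-- A squashing map from the full measurement `FM` to the target measurement `FQ`: a CPTP map
which turns the statistics of `FQ` into those of `FM`. -/
structure IsSquashingMap {κ : Type} (FM : κ → H →L[ℂ] H) (FQ : κ → K →L[ℂ] K)
    (Λ : traceClass H →ₗ[ℂ] traceClass K) : Prop where
  isCPTP : IsCPTP Λ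
  trace_eq : ∀ (ρ : traceClass H) (k : κ),
    trace ((ρ : H →L[ℂ] H) ∘L FM k) = trace ((Λ ρ : K →L[ℂ] K) ∘L FQ k)

/-- The compression of an operator on `H` to a closed subspace `U`, as an operator on `U`. -/
noncomputable def compress (U : Submodule ℂ H) [CompleteSpace U] (T : H →L[ℂ] H) : U →L[ℂ] U :=
  ContinuousLinearMap.adjoint U.subtypeL ∘L T ∘L U.subtypeL

end Channels

/-! ## The qubit target measurement -/

/-- The polarization space of one photon. -/
abbrev Qubit : Type := EuclideanSpace ℂ (Fin 2)

/-- The angle `2jπ/3`. -/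
noncomputable def angle (j : Fin 3) : ℝ := 2 * (j : ℝ) * Real.pi / 3

/-- The signal state `exp(i (2jπ/3) σ_y)|0⟩ = cos(2jπ/3)|0⟩ - sin(2jπ/3)|1⟩`. -/
noncomputable def signal (j : Fin 3) : Qubit :=
  !₂[(Real.cos (angle j) : ℂ), -(Real.sin (angle j) : ℂ)]

/-- The state orthogonal to the `k`-th signal state in the `X`-`Z` plane (up to a sign, which no
projector below depends on). -/
noncomputable def signalBar (k : Fin 3) : Qubit :=
  !₂[(Real.sin (angle k) : ℂ), (Real.cos (angle k) : ℂ)]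

theorem inner_signal_signalBar (k : Fin 3) : inner ℂ (signal k) (signalBar k) = 0 := by
  simp only [signal, signalBar, PiLp.inner_apply, Fin.sum_univ_two, RCLike.inner_apply]
  simp only [Matrix.cons_val_zero, Matrix.cons_val_one, map_neg,
    Complex.conj_ofReal]
  ring

/-- The target measurement `(2/3)|ψ̄_k⟩⟨ψ̄_k|`. -/
noncomputable def targetMeasurement (k : Fin 3) : Qubit →L[ℂ] Qubit :=
  (2 / 3 : ℂ) • InnerProductSpace.rankOne ℂ (signalBar k) (signalBar k)

/-! ## Threshold detectors on the `N`-photon space -/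

/-- The space of `N` photons in two polarization modes. The basis vector of index `m` is the
occupation number state with `N - m` photons in `|0⟩` and `m` photons in `|1⟩`. -/
abbrev Sector (N : ℕ) : Type := EuclideanSpace ℂ (Fin (N + 1))

open Polynomial in
/-- The creation operator of a photon in the state `signalBar k`, namely
`sin(2kπ/3) a₀† + cos(2kπ/3) a₁†`, as a polynomial in `X = a₁†`, with `a₀†` set to `1`. In a
product of `N` creation operators, the exponent of `a₀†` is recovered as `N` minus that of `X`. -/
noncomputable def creationBar (k : Fin 3) : Polynomial ℝ :=
  C (Real.sin (angle k)) + C (Real.cos (angle k)) * X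

open Nat in
/-- The coordinates of `∏ k, (creationBar k)^(n k) / √(n k)! |vac⟩` in the occupation number basis
of the `N`-photon space, where `(a₀†)^(N-m) (a₁†)^m |vac⟩ = √(N-m)! √m! |N-m, m⟩`. -/
noncomputable def fockCoeff (N : ℕ) (n : Fin 3 → ℕ) (m : ℕ) : ℝ :=
  (∏ k, creationBar k ^ n k).coeff m * (√(((N - m)! : ℝ) * m !) / √(∏ k, ((n k)! : ℝ)))

/-- The state `|n̄₀, n̄₁, n̄₂⟩` of `N = n₀ + n₁ + n₂` photons, `n k` of which are in the state
`signalBar k`. -/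
noncomputable def fockBar (N : ℕ) (n : Fin 3 → ℕ) : Sector N :=
  WithLp.toLp 2 fun m => (fockCoeff N n m : ℂ)

/-- A click pattern: the nonempty set of those detectors that click. -/
abbrev ClickPattern : Type := {s : Finset (Fin 3) // s.Nonempty}

/-- The occupation numbers of `N` photons for which exactly the detectors in `s` click. -/
def occupations (N : ℕ) (s : Finset (Fin 3)) : Finset (Fin 3 → ℕ) :=
  {n ∈ Finset.piAntidiag Finset.univ N | Finset.univ.filter (fun k => n k ≠ 0) = s}

/-- `∑ (2/3)^N |n̄₀, n̄₁, n̄₂⟩⟨n̄₀, n̄₁, n̄₂|` over the occupation numbers with click pattern `s`. -/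
noncomputable def clickOperator (N : ℕ) (s : Finset (Fin 3)) : Sector N →L[ℂ] Sector N :=
  ∑ n ∈ occupations N s,
    ((2 / 3 : ℂ) ^ N) • InnerProductSpace.rankOne ℂ (fockBar N n) (fockBar N n)

/-- The basic measurement on the `N`-photon space: single and double clicks are given by their
occupation number states, and the triple click is the rest of the identity. -/
noncomputable def basicSector (N : ℕ) (s : ClickPattern) : Sector N →L[ℂ] Sector N :=
  if s.1 = Finset.univ then
    1 - ∑ t : ClickPattern with t.1 ≠ Finset.univ, clickOperator N t.1
  else clickOperator N s.1

theorem coeff_identity (N : ℕ) (p q : ℕ) :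
    ∑ n ∈ Finset.piAntidiag (Finset.univ : Finset (Fin 3)) N,
      (Nat.multinomial Finset.univ n : ℝ) *
        ((∏ k, creationBar k ^ n k).coeff p * (∏ k, creationBar k ^ n k).coeff q)
      = (3 / 2 : ℝ) ^ N * (if p = q then (N.choose p : ℝ) else 0) := by
  have h1 : Real.sin (2 * 1 * Real.pi / 3) = √3 / 2 := by
    rw [show 2 * 1 * Real.pi / 3 = Real.pi - Real.pi / 3 by ring, Real.sin_pi_sub,
      Real.sin_pi_div_three]
  have h2 : Real.cos (2 * 1 * Real.pi / 3) = -(1 / 2) := by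
    rw [show 2 * 1 * Real.pi / 3 = Real.pi - Real.pi / 3 by ring, Real.cos_pi_sub,
      Real.cos_pi_div_three]
  have h3 : Real.sin (2 * 2 * Real.pi / 3) = -(√3 / 2) := by
    rw [show 2 * 2 * Real.pi / 3 = Real.pi / 3 + Real.pi by ring, Real.sin_add_pi,
      Real.sin_pi_div_three]
  have h4 : Real.cos (2 * 2 * Real.pi / 3) = -(1 / 2) := by
    rw [show 2 * 2 * Real.pi / 3 = Real.pi / 3 + Real.pi by ring, Real.cos_add_pi,
      Real.cos_pi_div_three]
  have hs : √3 * √3 = (3 : ℝ) := Real.mul_self_sqrt (by norm_num)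
  have key : ∑ k : Fin 3, (Polynomial.C (creationBar k) * (creationBar k).map Polynomial.C)
      = Polynomial.C (Polynomial.C (3 / 2 : ℝ)) *
        (Polynomial.C Polynomial.X * Polynomial.X + 1) := by
    simp only [Fin.sum_univ_three, creationBar, angle]
    simp only [Fin.val_zero, Fin.val_one, Fin.val_two, Nat.cast_zero, Nat.cast_one,
      Nat.cast_ofNat, h1, h2, h3, h4]
    have e : (Polynomial.C (Polynomial.C (√3 / 2)) : Polynomial (Polynomial ℝ)) *
        Polynomial.C (Polynomial.C (√3 / 2)) = Polynomial.C (Polynomial.C (3 / 4)) := by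
      rw [← Polynomial.C_mul, ← Polynomial.C_mul]
      congr 2
      linarith
    have e2 : (Polynomial.C (Polynomial.C (1 / 2)) : Polynomial (Polynomial ℝ)) *
        Polynomial.C (Polynomial.C (1 / 2)) = Polynomial.C (Polynomial.C (1 / 4)) := by
      rw [← Polynomial.C_mul, ← Polynomial.C_mul]
      congr 2
      norm_num
    have e3 : (Polynomial.C (Polynomial.C (3 / 4)) : Polynomial (Polynomial ℝ)) +
        Polynomial.C (Polynomial.C (3 / 4)) = Polynomial.C (Polynomial.C (3 / 2)) := by
      rw [← Polynomial.C_add, ← Polynomial.C_add]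
      congr 2
      norm_num
    have e4 : 1 + (Polynomial.C (Polynomial.C (1 / 4)) : Polynomial (Polynomial ℝ)) +
        Polynomial.C (Polynomial.C (1 / 4)) = Polynomial.C (Polynomial.C (3 / 2)) := by
      rw [← Polynomial.C_1, ← Polynomial.C_1, ← Polynomial.C_add, ← Polynomial.C_add,
        ← Polynomial.C_add, ← Polynomial.C_add]
      congr 2
      norm_num
    simp only [mul_zero, zero_mul, zero_div, Real.sin_zero, Real.cos_zero, Polynomial.C_0,
      Polynomial.C_1, Polynomial.map_add, Polynomial.map_mul, Polynomial.map_C, Polynomial.map_X,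
      Polynomial.C_add, Polynomial.C_mul, Polynomial.C_neg,
      Polynomial.map_neg, zero_add, one_mul]
    linear_combination
      (2 : Polynomial (Polynomial ℝ)) * e +
      2 * Polynomial.C Polynomial.X * Polynomial.X * e2 + e3 +
      Polynomial.C Polynomial.X * Polynomial.X * e4
  have hpow := congrArg (fun f => ((f ^ N).coeff q).coeff p) key
  simp only [Finset.sum_pow_eq_sum_piAntidiag] at hpow
  rw [Polynomial.finsetSum_coeff, Polynomial.finsetSum_coeff] at hpow
  have hl : ∀ n : Fin 3 → ℕ, ((((Nat.multinomial Finset.univ n : ℕ) : Polynomial (Polynomial ℝ)) *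
      ∏ k, (Polynomial.C (creationBar k) * (creationBar k).map Polynomial.C) ^ n k).coeff q).coeff p
      = (Nat.multinomial Finset.univ n : ℝ) *
        ((∏ k, creationBar k ^ n k).coeff p * (∏ k, creationBar k ^ n k).coeff q) := by
    intro n
    have : ∏ k, (Polynomial.C (creationBar k) * (creationBar k).map Polynomial.C) ^ n k
        = Polynomial.C (∏ k, creationBar k ^ n k) *
          (∏ k, creationBar k ^ n k).map Polynomial.C := by
      simp only [mul_pow, Finset.prod_mul_distrib, map_prod, map_pow, Polynomial.map_pow,
        Polynomial.map_prod]
    rw [this, Polynomial.coeff_natCast_mul, Polynomial.coeff_natCast_mul, Polynomial.coeff_C_mul,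
      Polynomial.coeff_map, Polynomial.coeff_mul_C]
  simp only [hl] at hpow
  rw [hpow, mul_pow, ← map_pow, ← map_pow, Polynomial.coeff_C_mul, Polynomial.coeff_C_mul]
  congr 1
  rw [add_pow, Polynomial.finsetSum_coeff, Polynomial.finsetSum_coeff]
  have hr : ∀ m : ℕ, (((((Polynomial.C Polynomial.X * Polynomial.X : Polynomial (Polynomial ℝ)) ^ m *
      1 ^ (N - m) * (N.choose m : Polynomial (Polynomial ℝ)))).coeff q).coeff p)
      = if q = m then (if p = m then (N.choose m : ℝ) else 0) else 0 := by
    intro m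
    rw [one_pow, mul_one, Polynomial.coeff_mul_natCast, Polynomial.coeff_mul_natCast, mul_pow,
      ← map_pow, Polynomial.coeff_C_mul, Polynomial.coeff_X_pow]
    by_cases hq : q = m <;> by_cases hp : p = m <;>
      simp [hq, hp, Polynomial.coeff_X_pow]
  simp only [hr]
  rw [Finset.sum_ite_eq]
  split_ifs with ha hb
  · rw [hb]
  · rfl
  · have : N < q := by simpa using ha
    rename_i hb
    rw [hb, Nat.choose_eq_zero_of_lt this, Nat.cast_zero]
  · rfl

theorem fockCoeff_identity (N : ℕ) (p q : Fin (N + 1)) :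
    ∑ n ∈ Finset.piAntidiag (Finset.univ : Finset (Fin 3)) N,
      (2 / 3 : ℝ) ^ N * (fockCoeff N n q * fockCoeff N n p) = if p = q then 1 else 0 := by
  have h := coeff_identity N p q
  have hN : ((N.factorial : ℕ) : ℝ) ≠ 0 := by exact_mod_cast N.factorial_ne_zero
  have h23 : (2 / 3 : ℝ) ^ N * (3 / 2 : ℝ) ^ N = 1 := by
    rw [← mul_pow]
    norm_num
  set r : ℕ → ℝ := fun m => √(((N - m).factorial : ℝ) * m.factorial) with hr
  have hterm : ∀ n ∈ Finset.piAntidiag (Finset.univ : Finset (Fin 3)) N,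
      (2 / 3 : ℝ) ^ N * (fockCoeff N n q * fockCoeff N n p)
      = (2 / 3 : ℝ) ^ N * (r p * r q / N.factorial) * ((Nat.multinomial Finset.univ n : ℝ) *
        ((∏ k, creationBar k ^ n k).coeff p * (∏ k, creationBar k ^ n k).coeff q)) := by
    intro n hn
    have hsum : ∑ k, n k = N := by simpa using (Finset.mem_piAntidiag.1 hn).1
    have hmul : (∏ k, ((n k).factorial : ℝ)) * (Nat.multinomial Finset.univ n : ℝ)
        = N.factorial := by
      have := Nat.multinomial_spec Finset.univ n
      rw [hsum] at this
      exact_mod_cast this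
    have hpos : 0 < ∏ k, ((n k).factorial : ℝ) :=
      Finset.prod_pos fun k _ => by exact_mod_cast (n k).factorial_pos
    have hsq : √(∏ k, ((n k).factorial : ℝ)) * √(∏ k, ((n k).factorial : ℝ))
        = ∏ k, ((n k).factorial : ℝ) := Real.mul_self_sqrt hpos.le
    have hne : √(∏ k, ((n k).factorial : ℝ)) ≠ 0 := (Real.sqrt_pos.2 hpos).ne'
    have hm : (Nat.multinomial Finset.univ n : ℝ) / N.factorial
        = 1 / (√(∏ k, ((n k).factorial : ℝ)) * √(∏ k, ((n k).factorial : ℝ))) := by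
      rw [hsq, ← hmul]
      have hmn : (Nat.multinomial Finset.univ n : ℝ) ≠ 0 := by
        intro h0
        rw [h0, mul_zero] at hmul
        exact hN hmul.symm
      field_simp
    calc (2 / 3 : ℝ) ^ N * (fockCoeff N n q * fockCoeff N n p)
        = (2 / 3 : ℝ) ^ N * (r p * r q) * ((∏ k, creationBar k ^ n k).coeff p *
          (∏ k, creationBar k ^ n k).coeff q) *
          (1 / (√(∏ k, ((n k).factorial : ℝ)) * √(∏ k, ((n k).factorial : ℝ)))) := by
          simp only [fockCoeff, hr]
          field_simp
      _ = _ := by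
          rw [← hm]
          ring
  rw [Finset.sum_congr rfl hterm, ← Finset.mul_sum, h]
  by_cases hpq : p = q
  · subst hpq
    have hle : (p : ℕ) ≤ N := Nat.lt_succ_iff.1 p.2
    have hrr : r p * r p = ((N - p).factorial : ℝ) * (p : ℕ).factorial :=
      Real.mul_self_sqrt (by positivity)
    have hch : ((N.choose p : ℕ) : ℝ) * ((p : ℕ).factorial : ℝ) * ((N - p).factorial : ℝ)
        = N.factorial := by exact_mod_cast Nat.choose_mul_factorial_mul_factorial hle
    simp only [if_true]
    rw [hrr]
    calc _ = ((2 / 3 : ℝ) ^ N * (3 / 2 : ℝ) ^ N) * (((N.choose p : ℕ) : ℝ) *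
        ((p : ℕ).factorial : ℝ) * ((N - p).factorial : ℝ)) / N.factorial := by ring
      _ = 1 := by rw [h23, hch, one_mul, div_self hN]
  · have : (p : ℕ) ≠ q := fun h => hpq (Fin.ext h)
    simp [hpq, this]

/-- Completeness: the operators of all occupation numbers of `N` photons sum to the identity. -/
theorem sum_rankOne_fockBar (N : ℕ) :
    ∑ n ∈ Finset.piAntidiag (Finset.univ : Finset (Fin 3)) N,
      ((2 / 3 : ℂ) ^ N) • InnerProductSpace.rankOne ℂ (fockBar N n) (fockBar N n)
      = (1 : Sector N →L[ℂ] Sector N) := by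
  ext v p
  have h : ∀ q : Fin (N + 1), ∑ n ∈ Finset.piAntidiag (Finset.univ : Finset (Fin 3)) N,
      (2 / 3 : ℂ) ^ N * ((fockCoeff N n q : ℂ) * (fockCoeff N n p : ℂ))
      = if p = q then 1 else 0 := by
    intro q
    have := congrArg (fun x : ℝ => (x : ℂ)) (fockCoeff_identity N p q)
    push_cast at this
    rw [this]
    split_ifs <;> simp
  simp only [sum_apply, smul_apply,
    InnerProductSpace.rankOne_apply, WithLp.ofLp_sum, Finset.sum_apply, PiLp.smul_apply,
    smul_eq_mul, one_apply_eq_self, PiLp.inner_apply, RCLike.inner_apply]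
  simp only [fockBar, Complex.conj_ofReal, Finset.sum_mul, Finset.mul_sum]
  rw [Finset.sum_comm]
  have : ∀ q : Fin (N + 1), ∑ n ∈ Finset.piAntidiag (Finset.univ : Finset (Fin 3)) N,
      (2 / 3 : ℂ) ^ N * (v q * (fockCoeff N n q : ℂ) * (fockCoeff N n p : ℂ))
      = v q * if p = q then 1 else 0 := by
    intro q
    rw [← h q, Finset.mul_sum]
    exact Finset.sum_congr rfl fun n _ => by ring
  rw [Finset.sum_congr rfl fun q _ => this q]
  simp

theorem norm_clickOperator_le (N : ℕ) (s : Finset (Fin 3)) : ‖clickOperator N s‖ ≤ 1 := by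
  have hpos : ∀ A : Finset (Fin 3 → ℕ), (∑ n ∈ A, ((2 / 3 : ℂ) ^ N) •
      InnerProductSpace.rankOne ℂ (fockBar N n) (fockBar N n)).IsPositive := by
    intro A
    rw [← ContinuousLinearMap.nonneg_iff_isPositive]
    refine Finset.sum_nonneg fun n _ => ?_
    rw [ContinuousLinearMap.nonneg_iff_isPositive]
    exact (InnerProductSpace.isPositive_rankOne_self _).smul_of_nonneg
      (pow_nonneg (by norm_num [Complex.le_def]) N)
  have h0 : 0 ≤ clickOperator N s := (ContinuousLinearMap.nonneg_iff_isPositive _).2 (hpos _)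
  have h1 : clickOperator N s ≤ 1 := by
    rw [← sum_rankOne_fockBar N, ContinuousLinearMap.le_def]
    have := Finset.sum_filter_add_sum_filter_not (Finset.piAntidiag (Finset.univ : Finset (Fin 3)) N)
      (fun n => Finset.univ.filter (fun k => n k ≠ 0) = s)
      (fun n => ((2 / 3 : ℂ) ^ N) • InnerProductSpace.rankOne ℂ (fockBar N n) (fockBar N n))
    rw [← this, clickOperator, occupations, add_sub_cancel_left]
    exact hpos _
  exact (CStarAlgebra.norm_le_one_iff_of_nonneg _ h0).2 h1

theorem exists_norm_basicSector_le (s : ClickPattern) :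
    ∃ C : ℝ, ∀ N : ℕ+, ‖basicSector N s‖ ≤ C := by
  by_cases hs : s.1 = Finset.univ
  · refine ⟨1 + ∑ t : ClickPattern with t.1 ≠ Finset.univ, (1 : ℝ), fun N => ?_⟩
    rw [basicSector, if_pos hs]
    refine (norm_sub_le _ _).trans (add_le_add ContinuousLinearMap.norm_id_le ?_)
    exact norm_sum_le_of_le _ fun t _ => norm_clickOperator_le N t.1
  · refine ⟨1, fun N => ?_⟩
    rw [basicSector, if_neg hs]
    exact norm_clickOperator_le N s.1

/-! ## Threshold detectors on all photon numbers `N ≥ 1` -/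

/-- The Hilbert space of a positive number of photons in two polarization modes: the Hilbert sum
of the `N`-photon spaces over `N ≥ 1`. -/
abbrev FockSpace : Type := lp (fun N : ℕ+ => Sector N) 2

/-- The direct sum of a bounded family of operators on the `N`-photon spaces. -/
noncomputable def directSum (T : ∀ N : ℕ+, Sector N →L[ℂ] Sector N)
    (hT : ∃ C : ℝ, ∀ N, ‖T N‖ ≤ C) : FockSpace →L[ℂ] FockSpace :=
  have hb : ∀ (C : ℝ), (∀ N, ‖T N‖ ≤ C) → ∀ (f : FockSpace) (N : ℕ+),
      ‖T N (f N)‖ ≤ ‖(C • f) N‖ := fun C hC f N => by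
    rw [lp.coeFn_smul, Pi.smul_apply, norm_smul]
    exact ((T N).le_opNorm _).trans
      (mul_le_mul_of_nonneg_right ((hC N).trans (le_abs_self C)) (norm_nonneg _))
  have hm : ∀ f : FockSpace, Memℓp (fun N => T N (f N)) 2 := fun f =>
    let ⟨C, hC⟩ := hT
    Memℓp.mono' (lp.memℓp (C • f)) (hb C hC f)
  LinearMap.mkContinuousOfExistsBound
    { toFun := fun f => ⟨fun N => T N (f N), hm f⟩
      map_add' := fun f g => by
        ext N : 2
        exact (T N).map_add (f N) (g N)
      map_smul' := fun c f => by
        ext N : 2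
        exact (T N).map_smul c (f N) }
    (let ⟨C, hC⟩ := hT
     ⟨|C|, fun f => by
      have := lp.norm_mono (p := 2) (by norm_num)
        (x := (⟨fun N => T N (f N), hm f⟩ : FockSpace)) (y := C • f) (hb C hC f)
      rwa [norm_smul, Real.norm_eq_abs] at this⟩)

theorem directSum_apply (T : ∀ N : ℕ+, Sector N →L[ℂ] Sector N)
    (hT : ∃ C : ℝ, ∀ N, ‖T N‖ ≤ C) (f : FockSpace) (N : ℕ+) :
    directSum T hT f N = T N (f N) := rfl

/-- The basic measurement by threshold detectors. -/
noncomputable def basicMeasurement (s : ClickPattern) : FockSpace →L[ℂ] FockSpace :=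
  directSum (fun N => basicSector N s) (exists_norm_basicSector_le s)

/-- The post-processing which keeps single clicks and assigns every multi-click event uniformly at
random to the three outcomes. -/
noncomputable def multiClickPost : Matrix (Fin 3) ClickPattern ℝ :=
  fun k s => if s.1.card = 1 then (if k ∈ s.1 then 1 else 0) else 1 / 3

/-- The coarse-grained full measurement. -/
noncomputable def fullMeasurement : Fin 3 → FockSpace →L[ℂ] FockSpace :=
  postProcess multiClickPost basicMeasurement

/-- The coarse-grained full measurement on the `N`-photon space. -/
noncomputable def fullSector (N : ℕ) : Fin 3 → Sector N →L[ℂ] Sector N :=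
  postProcess multiClickPost (basicSector N)

/-- The single-click subspace of the `N`-photon space, spanned by the three states in which all
photons have the same polarization `signalBar k`. -/
noncomputable def singleClickSpace (N : ℕ) : Submodule ℂ (Sector N) :=
  Submodule.span ℂ (Set.range fun k : Fin 3 => fockBar N (Pi.single k N))

noncomputable instance (N : ℕ) : CompleteSpace (singleClickSpace N) :=
  FiniteDimensional.complete ℂ _

end ThreeState

/-!
In the Heisenberg picture a squashing map is a unital completely positive map from the operators on
`ℂ²` to those on the detection space that sends `F_Q^(k)` to `F_M^(k)`. It is given by a `2 × 2`
matrix of operators `E a b`, the images of `|a⟩⟨b|`, and complete positivity means that the matrix is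
a positive operator on two copies of the detection space. As the states `ψ̄_k` are real, the
measurement fixes `E` up to an antisymmetric off-diagonal part (`liftBlocks`), which is to be chosen
so that `E` is positive.

The full measurement on `N` photons has the form `F^(k) = S_k + (1 - S_0 - S_1 - S_2) / 3` with
`S_k = (2/3)^N |v_k⟩⟨v_k|`, where `v_k` is the state of `N` photons in `ψ̄_k`; two different `v_k`
have the inner product `g = (-1/2)^N`. For `N = 1` it is the target measurement and the identity
channel gives the antisymmetric part (`liftBlocks_one_nonneg`). For `N ≥ 2` the antisymmetric part
zero works: in an orthonormal basis of the span of the `v_k` positivity amounts to `l (1 - g) ≤ 1/2`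
and `l² (1 + 2 g) (1 - g) ≤ 1/4` for `l = (2/3)^N` (`liftBlocks_evenFill_nonneg`). Positivity then
passes to the direct sum over `N` and to the compression to a subspace.

It remains to return to the Schrödinger picture (`dualMap`), on trace-class operators of a possibly
infinite-dimensional space. There a factorization `E a b = (G a)† G b`, obtained from the square
root of `E`, and the cyclicity `tr(ρ B C) = tr(C ρ B)` (`hasSum_trace_conj`) exhibit the map in
Kraus form. Cyclicity follows by writing a positive trace-class operator as the square of a
Hilbert–Schmidt operator, for which the double series of matrix entries converges absolutely.
-/

namespace ThreeState

/-! ### Hilbert–Schmidt operators and cyclicity of the trace -/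

section HilbertSchmidt

open ContinuousLinearMap

variable {H K L : Type}
  [NormedAddCommGroup H] [InnerProductSpace ℂ H] [CompleteSpace H]
  [NormedAddCommGroup K] [InnerProductSpace ℂ K] [CompleteSpace K]
  [NormedAddCommGroup L] [InnerProductSpace ℂ L] [CompleteSpace L]

/-- Hilbert–Schmidt operators, by the norms of the images of the fixed Hilbert basis. -/
def IsHilbertSchmidt (T : H →L[ℂ] K) : Prop :=
  Summable fun i => ‖T (stdBasis H i)‖ ^ 2

theorem hasSum_norm_inner_sq (x : H) :
    HasSum (fun i => ‖inner ℂ (stdBasis H i) x‖ ^ 2) (‖x‖ ^ 2) := by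
  rw [← Complex.hasSum_ofReal]
  have h := (stdBasis H).hasSum_inner_mul_inner x x
  have e : ∀ i, inner ℂ x (stdBasis H i) * inner ℂ (stdBasis H i) x
      = ((‖inner ℂ (stdBasis H i) x‖ ^ 2 : ℝ) : ℂ) := fun i => by
    rw [← inner_conj_symm x, Complex.conj_mul']
    push_cast
    rfl
  have e' : inner ℂ x x = ((‖x‖ ^ 2 : ℝ) : ℂ) := by
    rw [inner_self_eq_norm_sq_to_K]
    push_cast
    rfl
  simp only [e, e'] at h
  exact h

/-- A Hilbert–Schmidt operator is one whose matrix is square summable. -/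
theorem isHilbertSchmidt_iff (T : H →L[ℂ] K) :
    IsHilbertSchmidt T ↔
      Summable fun p : basisSet H × basisSet K =>
        ‖inner ℂ (stdBasis K p.2) (T (stdBasis H p.1))‖ ^ 2 := by
  rw [summable_prod_of_nonneg fun _ => by positivity]
  simp only [(hasSum_norm_inner_sq _).tsum_eq]
  exact ⟨fun h => ⟨fun _ => (hasSum_norm_inner_sq _).summable, h⟩, fun h => h.2⟩

theorem IsHilbertSchmidt.adjoint {T : H →L[ℂ] K} (hT : IsHilbertSchmidt T) :
    IsHilbertSchmidt (adjoint T) := by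
  rw [isHilbertSchmidt_iff] at hT ⊢
  refine hT.prod_symm.congr fun p => ?_
  rw [adjoint_inner_right, ← inner_conj_symm, RCLike.norm_conj]
  rfl

theorem IsHilbertSchmidt.comp_left {T : H →L[ℂ] K} (hT : IsHilbertSchmidt T) (B : K →L[ℂ] L) :
    IsHilbertSchmidt (B ∘L T) := by
  refine Summable.of_nonneg_of_le (fun _ => by positivity) (fun i => ?_)
    (Summable.mul_left (‖B‖ ^ 2) hT)
  rw [← mul_pow]
  exact pow_le_pow_left₀ (norm_nonneg _) (B.le_opNorm _) 2

theorem IsHilbertSchmidt.comp_right {T : H →L[ℂ] K} (hT : IsHilbertSchmidt T) (B : L →L[ℂ] H) :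
    IsHilbertSchmidt (T ∘L B) := by
  have := (hT.adjoint.comp_left (ContinuousLinearMap.adjoint B)).adjoint
  rwa [← adjoint_comp, adjoint_adjoint] at this

/-- The double series of matrix entries behind the trace of a product converges absolutely. -/
theorem summable_matrix_mul {S : K →L[ℂ] H} {T : H →L[ℂ] K} (hS : IsHilbertSchmidt S)
    (hT : IsHilbertSchmidt T) :
    Summable fun p : basisSet H × basisSet K =>
      inner ℂ (stdBasis H p.1) (S (stdBasis K p.2)) *
        inner ℂ (stdBasis K p.2) (T (stdBasis H p.1)) := by
  rw [isHilbertSchmidt_iff] at hS hT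
  refine Summable.of_norm_bounded (hS.prod_symm.add hT) fun p => ?_
  rw [norm_mul]
  simp only [Prod.fst_swap, Prod.snd_swap]
  nlinarith [sq_nonneg (‖inner ℂ (stdBasis H p.1) (S (stdBasis K p.2))‖ -
    ‖inner ℂ (stdBasis K p.2) (T (stdBasis H p.1))‖),
    sq_nonneg ‖inner ℂ (stdBasis H p.1) (S (stdBasis K p.2))‖,
    sq_nonneg ‖inner ℂ (stdBasis K p.2) (T (stdBasis H p.1))‖]

theorem hasSum_inner_comp (S : K →L[ℂ] H) (T : H →L[ℂ] K) (i : basisSet H) :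
    HasSum (fun j => inner ℂ (stdBasis H i) (S (stdBasis K j)) *
      inner ℂ (stdBasis K j) (T (stdBasis H i)))
      (inner ℂ (stdBasis H i) ((S ∘L T) (stdBasis H i))) := by
  have := (stdBasis K).hasSum_inner_mul_inner (ContinuousLinearMap.adjoint S (stdBasis H i))
    (T (stdBasis H i))
  simp only [adjoint_inner_left] at this
  exact this

theorem hasSum_trace_comp {S : K →L[ℂ] H} {T : H →L[ℂ] K} (hS : IsHilbertSchmidt S)
    (hT : IsHilbertSchmidt T) :
    HasSum (fun i => inner ℂ (stdBasis H i) ((S ∘L T) (stdBasis H i))) (trace (S ∘L T)) :=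
  ((summable_matrix_mul hS hT).hasSum.prod_fiberwise
    fun i => hasSum_inner_comp S T i).summable.hasSum

/-- The trace is cyclic on products of Hilbert–Schmidt operators. -/
theorem trace_comp_comm {S : K →L[ℂ] H} {T : H →L[ℂ] K} (hS : IsHilbertSchmidt S)
    (hT : IsHilbertSchmidt T) : trace (S ∘L T) = trace (T ∘L S) := by
  have h := summable_matrix_mul hS hT
  have h1 := (h.hasSum.prod_fiberwise fun i => hasSum_inner_comp S T i).tsum_eq
  have h2 := (h.prod_symm.hasSum.prod_fiberwise
    (g := fun j => inner ℂ (stdBasis K j) ((T ∘L S) (stdBasis K j))) fun j => by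
      simpa only [Prod.fst_swap, Prod.snd_swap, mul_comm] using hasSum_inner_comp T S j).tsum_eq
  rw [trace, trace, h1, h2]
  exact ((Equiv.prodComm _ _).tsum_eq _).symm

/-- A positive operator of finite trace is the square of a Hilbert–Schmidt operator. -/
theorem exists_sq_eq_of_isPositive {A : H →L[ℂ] H} (hA : A.IsPositive)
    (hs : Summable fun i => inner ℂ (stdBasis H i) (A (stdBasis H i))) :
    ∃ T : H →L[ℂ] H, IsHilbertSchmidt T ∧ A = T ∘L T := by
  have hA' : 0 ≤ A := (nonneg_iff_isPositive _).2 hA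
  have hT : (CFC.sqrt A).IsPositive := (nonneg_iff_isPositive _).1 (CFC.sqrt_nonneg A)
  have hTT : A = CFC.sqrt A ∘L CFC.sqrt A := (CFC.sqrt_mul_sqrt_self A hA').symm
  refine ⟨CFC.sqrt A, ?_, hTT⟩
  rw [IsHilbertSchmidt, ← Complex.summable_ofReal]
  refine hs.congr fun i => ?_
  conv_lhs => rw [hTT]
  rw [ContinuousLinearMap.comp_apply, ← hT.inner_left_eq_inner_right,
    inner_self_eq_norm_sq_to_K]
  push_cast
  rfl

/-- A trace-class operator between two bounded ones can be moved cyclically in the trace, and the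
trace is then a genuine sum. -/
theorem hasSum_trace_conj {ρ : H →L[ℂ] H} (hρ : ρ ∈ traceClass H) (B : K →L[ℂ] H)
    (C : H →L[ℂ] K) :
    HasSum (fun i => inner ℂ (stdBasis K i) ((C ∘L ρ ∘L B) (stdBasis K i)))
      (trace (ρ ∘L B ∘L C)) := by
  have main : ∀ ρ ∈ traceClass H,
      (Summable fun i => inner ℂ (stdBasis H i) ((ρ ∘L B ∘L C) (stdBasis H i))) ∧
      HasSum (fun i => inner ℂ (stdBasis K i) ((C ∘L ρ ∘L B) (stdBasis K i)))
        (trace (ρ ∘L B ∘L C)) := by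
    intro ρ hρ
    unfold traceClass at hρ
    induction hρ using Submodule.span_induction with
    | mem ρ h =>
      obtain ⟨T, hT, rfl⟩ := exists_sq_eq_of_isPositive h.1 h.2
      have hD := hT.comp_right (B ∘L C)
      -- `tr(T T D) = tr(T D T) = tr(C T T B)` for `D = B C`
      have e1 : trace (T ∘L T ∘L B ∘L C) = trace ((T ∘L B ∘L C) ∘L T) := trace_comp_comm hT hD
      have e2 : trace ((T ∘L B) ∘L C ∘L T) = trace ((C ∘L T) ∘L T ∘L B) :=
        trace_comp_comm (hT.comp_right B) (hT.comp_left C)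
      refine ⟨(hasSum_trace_comp hT hD).summable, ?_⟩
      have e3 : trace ((T ∘L T) ∘L B ∘L C) = trace ((C ∘L T) ∘L T ∘L B) := by
        rw [← e2]
        exact e1
      rw [e3]
      exact hasSum_trace_comp (S := C ∘L T) (T := T ∘L B) (hT.comp_left C) (hT.comp_right B)
    | zero => simp [trace, hasSum_zero, summable_zero]
    | add x y _ _ hx hy =>
      have hadd : trace ((x + y) ∘L B ∘L C) = trace (x ∘L B ∘L C) + trace (y ∘L B ∘L C) := by
        simp only [trace]
        rw [← hx.1.tsum_add hy.1]
        simp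
      refine ⟨by simpa [inner_add_right] using hx.1.add hy.1, ?_⟩
      rw [hadd]
      simpa [inner_add_right] using hx.2.add hy.2
    | smul a x _ hx =>
      have hsmul : trace ((a • x) ∘L B ∘L C) = a * trace (x ∘L B ∘L C) := by
        simp only [trace]
        rw [← tsum_mul_left]
        simp
      refine ⟨by simpa [inner_smul_right] using hx.1.mul_left a, ?_⟩
      rw [hsmul]
      simpa [inner_smul_right] using hx.2.mul_left a
  exact (main ρ hρ).2

theorem hasSum_trace_mul {ρ : H →L[ℂ] H} (hρ : ρ ∈ traceClass H) (B : H →L[ℂ] H) :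
    HasSum (fun i => inner ℂ (stdBasis H i) ((ρ ∘L B) (stdBasis H i))) (trace (ρ ∘L B)) :=
  hasSum_trace_conj hρ B (.id ℂ H)

end HilbertSchmidt

/-! ### The channel dual to a block-positive operator matrix -/

section DualChannel

open ContinuousLinearMap

/-- Every operator on a finite-dimensional space is trace class. -/
theorem traceClass_eq_top (K : Type) [NormedAddCommGroup K] [InnerProductSpace ℂ K]
    [FiniteDimensional ℂ K] [CompleteSpace K] : traceClass K = ⊤ := by
  have : Finite (basisSet K) := (stdBasis K).orthonormal.linearIndependent.finite
  rw [← CStarAlgebra.span_nonneg (A := K →L[ℂ] K), traceClass]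
  congr 1
  ext A
  exact ⟨fun h => (nonneg_iff_isPositive _).2 h.1,
    fun h => ⟨(nonneg_iff_isPositive _).1 h, Summable.of_finite⟩⟩

variable {H : Type} [NormedAddCommGroup H] [InnerProductSpace ℂ H] [CompleteSpace H]

theorem trace_rankOne (x y : H) : trace (InnerProductSpace.rankOne ℂ x y) = inner ℂ y x := by
  rw [trace, ← (stdBasis H).tsum_inner_mul_inner y x]
  simp only [InnerProductSpace.rankOne_apply, inner_smul_right]

/-- A positive operator on `H ⊕ H`, given by its blocks, factorizes. -/
theorem exists_factorization {E : Fin 2 → Fin 2 → H →L[ℂ] H}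
    (hE : ∀ u : Fin 2 → H, 0 ≤ ∑ a, ∑ b, inner ℂ (u a) (E a b (u b))) :
    ∃ G : Fin 2 → H →L[ℂ] PiLp 2 (fun _ : Fin 2 => H), ∀ a b, E a b = adjoint (G a) ∘L G b := by
  let π : Fin 2 → PiLp 2 (fun _ : Fin 2 => H) →L[ℂ] H := PiLp.proj 2 (𝕜 := ℂ) (fun _ => H)
  let T : PiLp 2 (fun _ : Fin 2 => H) →L[ℂ] PiLp 2 (fun _ : Fin 2 => H) :=
    ∑ a, ∑ b, adjoint (π a) ∘L E a b ∘L π b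
  have hT : 0 ≤ T := by
    rw [nonneg_iff_isPositive, isPositive_iff_complex]
    intro x
    have h : 0 ≤ inner ℂ x (T x) := by
      simpa [T, inner_sum, adjoint_inner_right] using hE fun a => π a x
    have h' : 0 ≤ inner ℂ (T x) x := by
      rw [← inner_conj_symm]
      simpa using star_nonneg_iff.2 h
    rw [Complex.le_def] at h'
    exact ⟨Complex.ext rfl h'.2, h'.1⟩
  have hTT : T = CFC.sqrt T ∘L CFC.sqrt T := (CFC.sqrt_mul_sqrt_self T hT).symm
  have hS : (CFC.sqrt T).IsPositive := (nonneg_iff_isPositive _).1 (CFC.sqrt_nonneg T)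
  have hπ : ∀ b x, adjoint (π b) x = PiLp.single 2 b x := fun b x => by
    refine ext_inner_right ℂ fun y => ?_
    rw [adjoint_inner_left, PiLp.inner_apply]
    rw [Finset.sum_eq_single b] <;> simp +contextual [π]
  have h : ∀ c b z, π c (adjoint (π b) z) = if c = b then z else 0 := fun c b z => by
    simp [hπ, π]
  refine ⟨fun a => CFC.sqrt T ∘L adjoint (π a), fun a b => ?_⟩
  rw [adjoint_comp, adjoint_adjoint, hS.isSelfAdjoint.adjoint_eq]
  refine ContinuousLinearMap.ext fun y => ext_inner_left ℂ fun x => ?_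
  have h0 : ∀ c d, inner ℂ (adjoint (π a) x) (adjoint (π c) (E c d (π d (adjoint (π b) y))))
      = if c = a then if d = b then inner ℂ x (E a b y) else 0 else 0 := fun c d => by
    rw [adjoint_inner_right, h, h]
    by_cases h1 : c = a <;> by_cases h2 : d = b <;> simp [h1, h2]
  calc inner ℂ x (E a b y) = inner ℂ (adjoint (π a) x) (T (adjoint (π b) y)) := by
        simp only [T, sum_apply, inner_sum, ContinuousLinearMap.comp_apply, h0]
        simp
    _ = inner ℂ x (π a (T (adjoint (π b) y))) := by rw [adjoint_inner_left]
    _ = _ := congrArg (fun R : PiLp 2 (fun _ : Fin 2 => H) →L[ℂ] PiLp 2 (fun _ : Fin 2 => H) =>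
        inner ℂ x (π a (R (adjoint (π b) y)))) hTT

/-- The Schrödinger picture of a `2 × 2` operator matrix `E`: the matrix entry `(a, b)` of the image
of `ρ` is `tr(ρ E b a)`. -/
noncomputable def dualMap (E : Fin 2 → Fin 2 → H →L[ℂ] H) :
    traceClass H →ₗ[ℂ] traceClass Qubit where
  toFun ρ := ⟨∑ a, ∑ b, trace ((ρ : H →L[ℂ] H) ∘L E b a) •
    InnerProductSpace.rankOne ℂ (EuclideanSpace.single a 1) (EuclideanSpace.single b 1),
    traceClass_eq_top Qubit ▸ Submodule.mem_top⟩
  map_add' ρ σ := by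
    have h : ∀ a b, trace ((ρ + σ : H →L[ℂ] H) ∘L E b a)
        = trace ((ρ : H →L[ℂ] H) ∘L E b a) + trace ((σ : H →L[ℂ] H) ∘L E b a) := fun a b => by
      simp only [trace]
      rw [← (hasSum_trace_mul ρ.2 (E b a)).summable.tsum_add
        (hasSum_trace_mul σ.2 (E b a)).summable]
      simp
    refine Subtype.ext ?_
    simp only [Submodule.coe_add, h, add_smul, Finset.sum_add_distrib]
  map_smul' c ρ := by
    have h : ∀ a b, trace ((c • ρ : H →L[ℂ] H) ∘L E b a)
        = c * trace ((ρ : H →L[ℂ] H) ∘L E b a) := fun a b => by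
      simp only [trace]
      rw [← tsum_mul_left]
      simp
    refine Subtype.ext ?_
    simp only [Submodule.coe_smul, h, mul_smul, Finset.smul_sum, RingHom.id_apply]

theorem coe_dualMap (E : Fin 2 → Fin 2 → H →L[ℂ] H) (ρ : traceClass H) :
    (dualMap E ρ : Qubit →L[ℂ] Qubit) = ∑ a, ∑ b, trace ((ρ : H →L[ℂ] H) ∘L E b a) •
      InnerProductSpace.rankOne ℂ (EuclideanSpace.single a 1) (EuclideanSpace.single b 1) := rfl

theorem trace_comp_sum (ρ : traceClass H) {ι : Type*} (s : Finset ι) (c : ι → ℂ)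
    (F : ι → H →L[ℂ] H) :
    trace ((ρ : H →L[ℂ] H) ∘L ∑ i ∈ s, c i • F i)
      = ∑ i ∈ s, c i * trace ((ρ : H →L[ℂ] H) ∘L F i) := by
  rw [trace, ← (hasSum_sum fun i _ => (hasSum_trace_mul ρ.2 (F i)).mul_left (c i)).tsum_eq]
  simp

theorem inner_dualMap (E : Fin 2 → Fin 2 → H →L[ℂ] H) (ρ : traceClass H) (x y : Qubit) :
    inner ℂ y ((dualMap E ρ : Qubit →L[ℂ] Qubit) x)
      = ∑ a, ∑ b, star (y a) * x b * trace ((ρ : H →L[ℂ] H) ∘L E b a) := by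
  rw [coe_dualMap]
  simp only [sum_apply, inner_sum, smul_apply, inner_smul_right, InnerProductSpace.rankOne_apply,
    EuclideanSpace.inner_single_left, EuclideanSpace.inner_single_right, map_one, one_mul]
  refine Finset.sum_congr rfl fun a _ => Finset.sum_congr rfl fun b _ => ?_
  rw [starRingEnd_apply]
  ring

theorem trace_dualMap_comp_rankOne (E : Fin 2 → Fin 2 → H →L[ℂ] H) (ρ : traceClass H)
    (x y : Qubit) :
    trace ((dualMap E ρ : Qubit →L[ℂ] Qubit) ∘L InnerProductSpace.rankOne ℂ x y)
      = ∑ a, ∑ b, star (y a) * x b * trace ((ρ : H →L[ℂ] H) ∘L E b a) := by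
  have h : (dualMap E ρ : Qubit →L[ℂ] Qubit) ∘L InnerProductSpace.rankOne ℂ x y
      = InnerProductSpace.rankOne ℂ ((dualMap E ρ : Qubit →L[ℂ] Qubit) x) y := by
    ext z
    simp [InnerProductSpace.rankOne_apply]
  rw [h, trace_rankOne, inner_dualMap]

/-- A factorization `E a b = (G a)† G b` yields Kraus operators of `dualMap E`, hence its complete
positivity. -/
theorem isCPTP_dualMap {E : Fin 2 → Fin 2 → H →L[ℂ] H}
    (hE : ∀ u : Fin 2 → H, 0 ≤ ∑ a, ∑ b, inner ℂ (u a) (E a b (u b))) (h1 : ∑ a, E a a = 1) :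
    IsCPTP (dualMap E) where
  completelyPositive n X hX v := by
    obtain ⟨G, hG⟩ := exists_factorization hE
    -- `tr(X E b a) = tr(G a X (G b)†)`, whose diagonal terms are values of the form `X`
    have hs : ∀ i j a b, HasSum
        (fun m => inner ℂ (adjoint (G a) (stdBasis _ m))
          ((X i j : H →L[ℂ] H) (adjoint (G b) (stdBasis _ m))))
        (trace ((X i j : H →L[ℂ] H) ∘L E b a)) := fun i j a b => by
      rw [hG]
      convert hasSum_trace_conj (X i j).2 (adjoint (G b)) (G a) using 2
      rw [adjoint_inner_left]
      rfl
    have hsum : HasSum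
        (fun m => ∑ i, ∑ j, inner ℂ (∑ a, v i a • adjoint (G a) (stdBasis _ m))
          ((X i j : H →L[ℂ] H) (∑ b, v j b • adjoint (G b) (stdBasis _ m))))
        (∑ i, ∑ j, inner ℂ (v i) ((dualMap E (X i j) : Qubit →L[ℂ] Qubit) (v j))) := by
      have := hasSum_sum fun i (_ : i ∈ Finset.univ) => hasSum_sum fun j (_ : j ∈ Finset.univ) =>
        hasSum_sum fun a (_ : a ∈ Finset.univ) => hasSum_sum fun b (_ : b ∈ Finset.univ) =>
        (hs i j a b).mul_left (star (v i a) * v j b)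
      have e1 : ∀ m, ∑ i, ∑ j, inner ℂ (∑ a, v i a • adjoint (G a) (stdBasis _ m))
          ((X i j : H →L[ℂ] H) (∑ b, v j b • adjoint (G b) (stdBasis _ m)))
          = ∑ i, ∑ j, ∑ a, ∑ b, star (v i a) * v j b * inner ℂ (adjoint (G a) (stdBasis _ m))
          ((X i j : H →L[ℂ] H) (adjoint (G b) (stdBasis _ m))) := fun m => by
        refine Finset.sum_congr rfl fun i _ => Finset.sum_congr rfl fun j _ => ?_
        rw [sum_inner]
        refine Finset.sum_congr rfl fun a _ => ?_
        rw [map_sum, inner_sum]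
        refine Finset.sum_congr rfl fun b _ => ?_
        rw [map_smul, inner_smul_left, inner_smul_right, starRingEnd_apply, mul_assoc]
      simp only [e1, inner_dualMap]
      exact this
    exact hsum.nonneg fun m => hX _
  tracePreserving ρ := by
    have h := trace_comp_sum ρ Finset.univ (fun _ : Fin 2 => (1 : ℂ)) fun a => E a a
    simp only [one_smul, h1, one_mul] at h
    have h2 : (ρ : H →L[ℂ] H) ∘L (1 : H →L[ℂ] H) = ρ := rfl
    rw [h2] at h
    have hone : ∑ a, (1 : ℂ) • InnerProductSpace.rankOne ℂ (EuclideanSpace.single a 1 : Qubit)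
        (EuclideanSpace.single a 1 : Qubit) = (1 : Qubit →L[ℂ] Qubit) := by
      ext z i
      fin_cases i <;> simp [InnerProductSpace.rankOne_apply, EuclideanSpace.inner_single_left]
    have h3 := trace_comp_sum (dualMap E ρ) Finset.univ (fun _ : Fin 2 => (1 : ℂ)) fun a =>
      InnerProductSpace.rankOne ℂ (EuclideanSpace.single a 1 : Qubit)
        (EuclideanSpace.single a 1 : Qubit)
    rw [hone] at h3
    simp only [trace_dualMap_comp_rankOne, one_mul] at h3
    rw [h]
    refine h3.trans ?_
    simp

/-! ### The blocks determined by the target measurement -/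

theorem angle_one : angle 1 = Real.pi - Real.pi / 3 := by
  simp only [angle, Fin.val_one, Nat.cast_one]
  ring

theorem angle_two : angle 2 = Real.pi / 3 + Real.pi := by
  simp only [angle, Fin.val_two, Nat.cast_ofNat]
  ring

theorem signalBar_zero : signalBar 0 = !₂[0, 1] := by
  simp [signalBar, angle]

theorem signalBar_one : signalBar 1 = !₂[(√3 / 2 : ℂ), (-(1 / 2) : ℂ)] := by
  rw [signalBar, angle_one, Real.sin_pi_sub, Real.cos_pi_sub, Real.sin_pi_div_three,
    Real.cos_pi_div_three]
  push_cast
  rfl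

theorem signalBar_two : signalBar 2 = !₂[(-(√3 / 2) : ℂ), (-(1 / 2) : ℂ)] := by
  rw [signalBar, angle_two, Real.sin_add_pi, Real.cos_add_pi, Real.sin_pi_div_three,
    Real.cos_pi_div_three]
  push_cast
  rfl

theorem ofReal_sqrt_three_sq : (√3 : ℂ) ^ 2 = 3 := by
  rw [← Complex.ofReal_pow, Real.sq_sqrt (by norm_num)]
  norm_num

/-- The blocks `E a b` (the images of `|a⟩⟨b|` under the dual of a squashing map) that the equations
`F k = ∑ (2/3) ⟨a|ψ̄_k⟩⟨ψ̄_k|b⟩ E a b` and `E 0 0 + E 1 1 = 1` require. The states `ψ̄_k` are real, so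
only the symmetric part of the off-diagonal blocks is determined; the antisymmetric part `Y`, half
the difference of `E 0 1` and `E 1 0`, is free. -/
noncomputable def liftBlocks (F : Fin 3 → H →L[ℂ] H) (Y : H →L[ℂ] H) (a b : Fin 2) : H →L[ℂ] H :=
  !![1 - (3 / 2 : ℂ) • F 0, (√3 / 2 : ℂ) • (F 2 - F 1) + Y;
    (√3 / 2 : ℂ) • (F 2 - F 1) - Y, (3 / 2 : ℂ) • F 0] a b

/-- A measurement whose lifted blocks form a positive operator on `H ⊕ H` can be squashed. -/
theorem exists_isSquashingMap {F : Fin 3 → H →L[ℂ] H} (hF : ∑ k, F k = 1) (Y : H →L[ℂ] H)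
    (hY : ∀ u : Fin 2 → H, 0 ≤ ∑ a, ∑ b, inner ℂ (u a) (liftBlocks F Y a b (u b))) :
    ∃ Λ : traceClass H →ₗ[ℂ] traceClass Qubit, IsSquashingMap F targetMeasurement Λ := by
  refine ⟨dualMap (liftBlocks F Y), isCPTP_dualMap hY ?_, fun ρ k => ?_⟩
  · simp [liftBlocks]
  · have hk : F k = ∑ p : Fin 2 × Fin 2,
        ((2 / 3 : ℂ) * (star (signalBar k p.1) * signalBar k p.2)) • liftBlocks F Y p.2 p.1 := by
      have hs := ofReal_sqrt_three_sq
      rw [Fin.sum_univ_three] at hF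
      fin_cases k
      · simp [Fintype.sum_prod_type, liftBlocks, signalBar_zero, smul_smul]
      · simp [Fintype.sum_prod_type, liftBlocks, signalBar_one, ← hF]
        match_scalars <;> ring_nf <;> simp only [hs, map_ofNat] <;> norm_num
      · simp [Fintype.sum_prod_type, liftBlocks, signalBar_two, ← hF]
        match_scalars <;> ring_nf <;> simp only [hs, map_ofNat] <;> norm_num
    have ht : trace ((dualMap (liftBlocks F Y) ρ : Qubit →L[ℂ] Qubit) ∘L targetMeasurement k)
        = (2 / 3 : ℂ) * trace ((dualMap (liftBlocks F Y) ρ : Qubit →L[ℂ] Qubit) ∘L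
          InnerProductSpace.rankOne ℂ (signalBar k) (signalBar k)) := by
      simpa [targetMeasurement] using trace_comp_sum (dualMap (liftBlocks F Y) ρ) {k}
        (fun _ => (2 / 3 : ℂ)) fun k => InnerProductSpace.rankOne ℂ (signalBar k) (signalBar k)
    conv_lhs => rw [hk]
    rw [ht, trace_dualMap_comp_rankOne, trace_comp_sum, Fintype.sum_prod_type]
    simp only [Finset.mul_sum, mul_assoc]

end DualChannel

/-! ### The full measurement on the `N`-photon space -/

/-- The triple click drops out of the coarse-grained measurement: all but the single clicks enter
only through the sum of all outcomes. -/
theorem postProcess_multiClickPost {H : Type} [NormedAddCommGroup H] [InnerProductSpace ℂ H]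
    (F : ClickPattern → H →L[ℂ] H) (k : Fin 3) :
    postProcess multiClickPost F k = F ⟨{k}, Finset.singleton_nonempty k⟩ +
      (1 / 3 : ℂ) • (∑ s, F s - ∑ j : Fin 3, F ⟨{j}, Finset.singleton_nonempty j⟩) := by
  have hP : ∀ s : ClickPattern, ((multiClickPost k s : ℝ) : ℂ) =
      (if s = ⟨{k}, Finset.singleton_nonempty k⟩ then 1 else 0) + 1 / 3 -
        (1 / 3) * ∑ j : Fin 3, if s = ⟨{j}, Finset.singleton_nonempty j⟩ then 1 else 0 := by
    intro s
    by_cases hs : s.1.card = 1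
    · obtain ⟨i, hi⟩ := Finset.card_eq_one.1 hs
      obtain ⟨s, h⟩ := s
      obtain rfl : s = {i} := hi
      by_cases hk : k = i
      · simp [multiClickPost, Subtype.ext_iff, hk]
      · simp [multiClickPost, Subtype.ext_iff, hk, Ne.symm hk]
    · have h : ∀ i, s ≠ ⟨{i}, Finset.singleton_nonempty i⟩ := fun i h => hs (by simp [h])
      simp [multiClickPost, hs, h]
  simp only [postProcess, hP, sub_smul, add_smul, mul_smul, Finset.sum_sub_distrib,
    Finset.sum_add_distrib, ite_smul, one_smul, zero_smul, Finset.sum_ite_eq', Finset.mem_univ,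
    if_true, Finset.sum_smul, ← Finset.smul_sum]
  rw [Finset.sum_comm]
  simp only [Finset.sum_ite_eq', Finset.mem_univ, if_true, smul_sub]
  abel

theorem sum_postProcess_multiClickPost {H : Type} [NormedAddCommGroup H] [InnerProductSpace ℂ H]
    (F : ClickPattern → H →L[ℂ] H) : ∑ k, postProcess multiClickPost F k = ∑ s, F s := by
  simp only [postProcess_multiClickPost, Finset.sum_add_distrib, Finset.sum_const,
    Finset.card_univ, Fintype.card_fin]
  module

theorem sum_basicSector (N : ℕ) : ∑ s, basicSector N s = 1 := by
  have h : Finset.univ.filter (fun t : ClickPattern => t.1 = Finset.univ)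
      = {⟨Finset.univ, Finset.univ_nonempty⟩} := by
    ext t
    simp [Subtype.ext_iff]
  rw [← Finset.sum_filter_add_sum_filter_not _ (fun t : ClickPattern => t.1 = Finset.univ), h,
    Finset.sum_singleton]
  have h' : ∀ t ∈ Finset.univ.filter (fun t : ClickPattern => ¬t.1 = Finset.univ),
      basicSector N t = clickOperator N t.1 := fun t ht => if_neg (Finset.mem_filter.1 ht).2
  rw [Finset.sum_congr rfl h', basicSector, if_pos rfl]
  exact sub_add_cancel _ _

theorem sum_fullSector (N : ℕ) : ∑ k, fullSector N k = 1 :=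
  (sum_postProcess_multiClickPost _).trans (sum_basicSector N)

/-- The state of `N` photons with polarization `signalBar k`. -/
noncomputable def clickState (N : ℕ) (k : Fin 3) : Sector N := fockBar N (Pi.single k N)

theorem occupations_singleton {N : ℕ} (hN : N ≠ 0) (k : Fin 3) :
    occupations N {k} = {Pi.single k N} := by
  ext n
  simp only [occupations, Finset.mem_filter, Finset.mem_piAntidiag, Finset.mem_singleton]
  constructor
  · rintro ⟨⟨hsum, -⟩, hn⟩
    have h : ∀ i, i ≠ k → n i = 0 := fun i hi => by
      by_contra h0
      have : i ∈ Finset.univ.filter fun k => n k ≠ 0 := by simp [h0]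
      rw [hn, Finset.mem_singleton] at this
      exact hi this
    rw [Finset.sum_eq_single k (fun i _ hi => h i hi) (by simp)] at hsum
    ext i
    by_cases hi : i = k
    · subst hi
      simp [hsum]
    · simp [hi, h i hi]
  · rintro rfl
    refine ⟨⟨by simp, by simp⟩, ?_⟩
    ext i
    simp [Pi.single_apply, hN]

/-- A measurement that consists of the multiples `l |v k⟩⟨v k|`, the rest of the identity being
distributed evenly. -/
noncomputable def evenFill {H : Type} [NormedAddCommGroup H] [InnerProductSpace ℂ H]
    (l : ℝ) (v : Fin 3 → H) (k : Fin 3) : H →L[ℂ] H :=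
  (l : ℂ) • InnerProductSpace.rankOne ℂ (v k) (v k) +
    (1 / 3 : ℂ) • (1 - ∑ j, (l : ℂ) • InnerProductSpace.rankOne ℂ (v j) (v j))

theorem fullSector_eq_evenFill {N : ℕ} (hN : N ≠ 0) :
    fullSector N = evenFill ((2 / 3) ^ N) (clickState N) := by
  have h : ∀ k, basicSector N ⟨{k}, Finset.singleton_nonempty k⟩ =
      (((2 / 3) ^ N : ℝ) : ℂ) • InnerProductSpace.rankOne ℂ (clickState N k) (clickState N k) := by
    intro k
    have : ({k} : Finset (Fin 3)) ≠ Finset.univ := fun h => by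
      simpa using congrArg Finset.card h
    rw [basicSector, if_neg this, clickOperator, occupations_singleton hN, Finset.sum_singleton]
    push_cast
    rfl
  funext k
  rw [fullSector, postProcess_multiClickPost, sum_basicSector, evenFill]
  simp only [h]

theorem fockCoeff_single (N : ℕ) (k : Fin 3) {m : ℕ} (hm : m ≤ N) :
    fockCoeff N (Pi.single k N) m =
      √(N.choose m) * (Real.sin (angle k) ^ (N - m) * Real.cos (angle k) ^ m) := by
  have h1 : ∏ i, creationBar i ^ (Pi.single k N : Fin 3 → ℕ) i = creationBar k ^ N := by
    rw [Finset.prod_eq_single k] <;> simp +contextual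
  have h2 : ∏ i, (((Pi.single k N : Fin 3 → ℕ) i).factorial : ℝ) = N.factorial := by
    rw [Finset.prod_eq_single k] <;> simp +contextual
  have h3 : (creationBar k ^ N).coeff m
      = N.choose m * (Real.sin (angle k) ^ (N - m) * Real.cos (angle k) ^ m) := by
    rw [creationBar, add_comm, add_pow, Polynomial.finsetSum_coeff, Finset.sum_eq_single m]
    · rw [mul_pow, ← map_pow, ← map_pow, Polynomial.coeff_mul_natCast, Polynomial.coeff_mul_C,
        Polynomial.coeff_C_mul, Polynomial.coeff_X_pow_self]
      ring
    · intro i _ hi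
      rw [mul_pow, ← map_pow, ← map_pow, Polynomial.coeff_mul_natCast, Polynomial.coeff_mul_C,
        Polynomial.coeff_C_mul, Polynomial.coeff_X_pow, if_neg hi.symm]
      ring
    · intro h
      exact absurd (Finset.mem_range.2 (Nat.lt_succ_of_le hm)) h
  have h4 : (N.choose m : ℝ) * (((N - m).factorial : ℝ) * m.factorial) = N.factorial := by
    have := Nat.choose_mul_factorial_mul_factorial hm
    rw [mul_comm ((N - m).factorial : ℝ), ← mul_assoc]
    exact_mod_cast this
  have h5 : (0 : ℝ) < ((N - m).factorial : ℝ) * m.factorial := by positivity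
  have h6 : (0 : ℝ) < N.choose m := by exact_mod_cast Nat.choose_pos hm
  rw [fockCoeff, h1, h2, h3, ← h4, Real.sqrt_mul h6.le]
  have h7 := (Real.sqrt_pos.2 h5).ne'
  have h8 := (Real.sqrt_pos.2 h6).ne'
  field_simp
  rw [Real.sq_sqrt h6.le]
  ring

theorem inner_signalBar (j k : Fin 3) :
    Real.sin (angle j) * Real.sin (angle k) + Real.cos (angle j) * Real.cos (angle k)
      = if j = k then 1 else -(1 / 2) := by
  have hs : √3 * √3 = (3 : ℝ) := Real.mul_self_sqrt (by norm_num)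
  have e : ∀ i, Real.sin (angle i) = ![0, √3 / 2, -(√3 / 2)] i ∧
      Real.cos (angle i) = ![1, -(1 / 2), -(1 / 2)] i := by
    intro i
    fin_cases i
    · simp [angle]
    · simp [angle_one, Real.sin_pi_sub, Real.cos_pi_sub]
    · simp [angle_two, Real.sin_add_pi, Real.cos_add_pi]
  rw [(e j).1, (e j).2, (e k).1, (e k).2]
  fin_cases j <;> fin_cases k <;> simp <;> nlinarith

/-- `N`-th tensor powers have the `N`-th powers of the inner products of the polarizations. -/
theorem inner_clickState (N : ℕ) (j k : Fin 3) :
    inner ℂ (clickState N j) (clickState N k)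
      = ((if j = k then 1 else (-(1 / 2)) ^ N : ℝ) : ℂ) := by
  have h : (if j = k then 1 else (-(1 / 2)) ^ N : ℝ) = (if j = k then 1 else -(1 / 2)) ^ N := by
    split_ifs <;> simp
  rw [h, ← inner_signalBar, add_comm (Real.sin _ * _), add_pow, Complex.ofReal_sum,
    Finset.sum_range]
  refine (PiLp.inner_apply _ _).trans ?_
  refine Finset.sum_congr rfl fun m _ => ?_
  have hm : (m : ℕ) ≤ N := Nat.lt_succ_iff.1 m.2
  have hc : √(N.choose m : ℝ) * √(N.choose m : ℝ) = N.choose m :=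
    Real.mul_self_sqrt (Nat.cast_nonneg _)
  rw [RCLike.inner_apply]
  simp only [clickState, fockBar, Complex.conj_ofReal, fockCoeff_single N _ hm]
  rw [← Complex.ofReal_mul]
  congr 1
  linear_combination (Real.sin (angle k) ^ (N - m) * Real.cos (angle k) ^ (m : ℕ) *
    Real.sin (angle j) ^ (N - m) * Real.cos (angle j) ^ (m : ℕ)) * hc

/-! ### Positivity of the lifted blocks -/

/-- Completing squares in the orthogonal coordinates `x 1 ± y 2` and `x 2 ± y 1` bounds the couplings
of `x 0` and `y 0` by `m² ≤ 1/2`, and the remaining negative square by `n ≤ 1/4`. -/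
theorem quadraticForm_nonneg {m n : ℝ} (hm : m ^ 2 ≤ 1 / 2) (hn0 : 0 ≤ n) (hn : n ≤ 1 / 4)
    (x y : Fin 3 → ℝ) :
    0 ≤ (x 0 ^ 2 + x 1 ^ 2 + x 2 ^ 2 + (y 0 ^ 2 + y 1 ^ 2 + y 2 ^ 2)) / 2 -
      m * x 0 * (x 1 + y 2) + m * y 0 * (y 1 - x 2) - n * (x 1 - y 2) ^ 2 +
      n * (x 2 + y 1) ^ 2 := by
  have h1 := mul_nonneg (sub_nonneg.2 hm) (sq_nonneg (x 1 + y 2))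
  have h2 := mul_nonneg (sub_nonneg.2 hm) (sq_nonneg (y 1 - x 2))
  have h3 := mul_nonneg (sub_nonneg.2 hn) (sq_nonneg (x 1 - y 2))
  have h4 := mul_nonneg hn0 (sq_nonneg (x 2 + y 1))
  nlinarith [sq_nonneg (x 0 - m * (x 1 + y 2)), sq_nonneg (y 0 + m * (y 1 - x 2)),
    sq_nonneg (x 2 + y 1)]

/-- The form of the lifted blocks in terms of the overlaps `A` and `B` with the three vectors. -/
theorem inner_liftBlocks_evenFill {H : Type} [NormedAddCommGroup H] [InnerProductSpace ℂ H]
    (l : ℝ) (v : Fin 3 → H) (u : Fin 2 → H) (A B : Fin 3 → ℂ) (hA : ∀ k, inner ℂ (v k) (u 0) = A k)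
    (hB : ∀ k, inner ℂ (v k) (u 1) = B k) :
    ∑ a, ∑ b, inner ℂ (u a) (liftBlocks (evenFill l v) 0 a b (u b)) =
      ((‖u 0‖ ^ 2 + ‖u 1‖ ^ 2) / 2 : ℝ)
      - l * (star (A 0) * A 0 - (star (A 1) * A 1 + star (A 2) * A 2) / 2)
      + l * (star (B 0) * B 0 - (star (B 1) * B 1 + star (B 2) * B 2) / 2)
      + √3 / 2 * l * (star (A 2) * B 2 - star (A 1) * B 1 + star (B 2) * A 2 - star (B 1) * A 1) := by
  have hA' : ∀ k, inner ℂ (u 0) (v k) = star (A k) := fun k => by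
    rw [← hA, ← inner_conj_symm, starRingEnd_apply]
  have hB' : ∀ k, inner ℂ (u 1) (v k) = star (B k) := fun k => by
    rw [← hB, ← inner_conj_symm, starRingEnd_apply]
  have h0 : ∀ i, inner ℂ (u i) (u i) = (‖u i‖ : ℂ) ^ 2 := fun i => inner_self_eq_norm_sq_to_K _
  simp only [liftBlocks, evenFill, Fin.sum_univ_three, Fin.sum_univ_two, Matrix.of_apply,
    Matrix.cons_val_zero, Matrix.cons_val_one, add_zero, sub_zero, add_apply, sub_apply,
    smul_apply, one_apply_eq_self, Matrix.cons_val', Matrix.cons_val_fin_one,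
    inner_add_right, inner_sub_right, inner_smul_right, InnerProductSpace.rankOne_apply, hA, hB,
    hA', hB', h0]
  push_cast
  ring

/-- Let three vectors have the Gram matrix with diagonal `1` and all other entries `g`. The blocks
lifted from the measurement they define, with antisymmetric part `0`, are positive if `l (1 - g)`
and `l² (1 + 2 g) (1 - g)` are small. In coordinates with respect to an orthonormal basis adapted to
the permutation symmetry, the form is that of `quadraticForm_nonneg` on real and imaginary parts. -/
theorem liftBlocks_evenFill_nonneg {H : Type} [NormedAddCommGroup H] [InnerProductSpace ℂ H]
    {l g : ℝ} {v : Fin 3 → H}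
    (hv : ∀ j k, inner ℂ (v j) (v k) = ((if j = k then 1 else g : ℝ) : ℂ))
    (hl : 0 ≤ l) (hg0 : 0 < 1 + 2 * g) (hg1 : 0 < 1 - g) (h1 : l * (1 - g) ≤ 1 / 2)
    (h2 : l ^ 2 * ((1 + 2 * g) * (1 - g)) ≤ 1 / 4) (u : Fin 2 → H) :
    0 ≤ ∑ a, ∑ b, inner ℂ (u a) (liftBlocks (evenFill l v) 0 a b (u b)) := by
  obtain ⟨p, hp, hpg⟩ : ∃ p : ℝ, 0 < p ∧ 1 + 2 * g = 3 * p ^ 2 :=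
    ⟨√((1 + 2 * g) / 3), Real.sqrt_pos.2 (by positivity), by
      rw [Real.sq_sqrt (by positivity)]; ring⟩
  obtain ⟨q, hq, hqg⟩ : ∃ q : ℝ, 0 < q ∧ 1 - g = 6 * q ^ 2 :=
    ⟨√((1 - g) / 6), Real.sqrt_pos.2 (by positivity), by
      rw [Real.sq_sqrt (by positivity)]; ring⟩
  have hg : g = 1 - 6 * q ^ 2 := by linarith
  have hpq : p ^ 2 = 1 - 4 * q ^ 2 := by linarith
  have hs : √3 ^ 2 = (3 : ℝ) := Real.sq_sqrt (by norm_num)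
  have hs0 : (0 : ℝ) < √3 := by positivity
  have hsC := ofReal_sqrt_three_sq
  have hpC : (p : ℂ) ≠ 0 := by exact_mod_cast hp.ne'
  have hqC : (q : ℂ) ≠ 0 := by exact_mod_cast hq.ne'
  have hs0C : (√3 : ℂ) ≠ 0 := by exact_mod_cast hs0.ne'
  have hpqC : (p : ℂ) ^ 2 = 1 - 4 * (q : ℂ) ^ 2 := by exact_mod_cast congrArg ((↑) : ℝ → ℂ) hpq
  -- the invariant vector, and the reflection-symmetric and antisymmetric ones orthogonal to it
  let w : Fin 3 → H := ![(1 / (3 * p) : ℂ) • (v 0 + v 1 + v 2),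
    (1 / (6 * q) : ℂ) • ((2 : ℂ) • v 0 - v 1 - v 2), (1 / (2 * √3 * q) : ℂ) • (v 1 - v 2)]
  have hw : Orthonormal ℂ w := by
    rw [orthonormal_iff_ite]
    intro i j
    fin_cases i <;> fin_cases j <;>
      simp only [w, Fin.zero_eta, Fin.mk_one, Fin.reduceFinMk, Matrix.cons_val, inner_add_left,
        inner_add_right, inner_sub_left, inner_sub_right, inner_smul_left, inner_smul_right, hv,
        hg, map_div₀, map_mul, map_one, map_ofNat, Complex.conj_ofReal, Fin.reduceEq, if_true,
        if_false, Complex.ofReal_one, Complex.ofReal_sub, Complex.ofReal_mul, Complex.ofReal_pow,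
        Complex.ofReal_ofNat] <;> field_simp <;>
      first
      | ring1
      | linear_combination (-9 : ℂ) * hpqC
      | linear_combination (-4 * (q : ℂ) ^ 2) * hsC
  have hv0 : v 0 = (p : ℂ) • w 0 + (2 * q : ℂ) • w 1 := by
    simp only [w, Matrix.cons_val]
    match_scalars <;> field_simp <;> norm_num
  have hv1 : v 1 = (p : ℂ) • w 0 - (q : ℂ) • w 1 + (√3 * q : ℂ) • w 2 := by
    simp only [w, Matrix.cons_val]
    match_scalars <;> field_simp <;> norm_num
  have hv2 : v 2 = (p : ℂ) • w 0 - (q : ℂ) • w 1 - (√3 * q : ℂ) • w 2 := by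
    simp only [w, Matrix.cons_val]
    match_scalars <;> field_simp <;> norm_num
  let c : Fin 2 → Fin 3 → ℂ := fun a i => inner ℂ (w i) (u a)
  let d : Fin 2 → Fin 3 → ℂ := fun a =>
    ![p * c a 0 + 2 * q * c a 1, p * c a 0 - q * c a 1 + √3 * q * c a 2,
      p * c a 0 - q * c a 1 - √3 * q * c a 2]
  have hd : ∀ a k, inner ℂ (v k) (u a) = d a k := by
    intro a k
    fin_cases k
    · change inner ℂ (v 0) (u a) = _
      rw [hv0]
      simp only [inner_add_left, inner_smul_left, map_mul, Complex.conj_ofReal,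
        map_ofNat]
      rfl
    · change inner ℂ (v 1) (u a) = _
      rw [hv1]
      simp only [inner_add_left, inner_sub_left, inner_smul_left, map_mul, Complex.conj_ofReal]
      rfl
    · change inner ℂ (v 2) (u a) = _
      rw [hv2]
      simp only [inner_sub_left, inner_smul_left, map_mul, Complex.conj_ofReal]
      rfl
  have hb : ∀ a, (c a 0).re ^ 2 + (c a 1).re ^ 2 + (c a 2).re ^ 2 +
      ((c a 0).im ^ 2 + (c a 1).im ^ 2 + (c a 2).im ^ 2) ≤ ‖u a‖ ^ 2 := by
    intro a
    have := hw.sum_inner_products_le (u a) (s := Finset.univ)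
    simp only [Fin.sum_univ_three, ← Complex.normSq_eq_norm_sq, Complex.normSq_apply] at this
    simp only [c]
    linarith
  -- Bessel's inequality `hb` replaces the norms by the coordinates
  rw [inner_liftBlocks_evenFill l v u (d 0) (d 1) (hd 0) (hd 1)]
  have hm : (6 * l * p * q) ^ 2 ≤ 1 / 2 := by
    have : (6 * l * p * q) ^ 2 = 2 * (l ^ 2 * ((1 + 2 * g) * (1 - g))) := by
      rw [hpg, hqg]; ring
    linarith
  have hn0 : 0 ≤ 3 * l * q ^ 2 := by positivity
  have hn : 3 * l * q ^ 2 ≤ 1 / 4 := by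
    rw [hqg] at h1
    linarith
  have hre := quadraticForm_nonneg hm hn0 hn (fun i => (c 0 i).re) (fun i => (c 1 i).re)
  have him := quadraticForm_nonneg hm hn0 hn (fun i => (c 0 i).im) (fun i => (c 1 i).im)
  have h0 := hb 0
  have h1 := hb 1
  rw [Complex.le_def]
  simp only [d, Matrix.cons_val, Complex.star_def, Complex.add_re, Complex.add_im, Complex.sub_re,
    Complex.sub_im, Complex.mul_re, Complex.mul_im, Complex.conj_re, Complex.conj_im,
    Complex.ofReal_re, Complex.ofReal_im, Complex.div_ofNat_re, Complex.div_ofNat_im,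
    Complex.zero_re, Complex.zero_im, Complex.re_ofNat, Complex.im_ofNat]
  generalize c 0 0 = x0 at *
  generalize c 0 1 = x1 at *
  generalize c 0 2 = x2 at *
  generalize c 1 0 = y0 at *
  generalize c 1 1 = y1 at *
  generalize c 1 2 = y2 at *
  refine ⟨?_, by ring⟩
  linear_combination hre + him + h0 / 2 + h1 / 2 - l * (q ^ 2 * (x2.re ^ 2 + x2.im ^ 2 -
    y2.re ^ 2 - y2.im ^ 2) - 2 * q * ((p * x0.re - q * x1.re) * y2.re +
    (p * x0.im - q * x1.im) * y2.im + x2.re * (p * y0.re - q * y1.re) +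
    x2.im * (p * y0.im - q * y1.im))) * hs

/-- For `N ≥ 2` the overlaps `(-1/2) ^ N` and the weights `(2/3) ^ N` are small enough that the
antisymmetric part can be chosen to be zero. -/
theorem liftBlocks_clickState_nonneg {N : ℕ} (hN : 2 ≤ N) (u : Fin 2 → Sector N) :
    0 ≤ ∑ a, ∑ b, inner ℂ (u a)
      (liftBlocks (evenFill ((2 / 3) ^ N) (clickState N)) 0 a b (u b)) := by
  refine liftBlocks_evenFill_nonneg (inner_clickState N) (by positivity) ?_ ?_ ?_ ?_ u <;>
    obtain rfl | hN := hN.eq_or_lt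
  all_goals try norm_num
  all_goals
    have hl : (2 / 3 : ℝ) ^ N ≤ 8 / 27 :=
      (pow_le_pow_of_le_one (by norm_num) (by norm_num) hN).trans (by norm_num)
    have hl0 : (0 : ℝ) ≤ (2 / 3) ^ N := by positivity
    have hg : |(-(1 / 2) : ℝ) ^ N| ≤ 1 / 8 := by
      rw [abs_pow, abs_neg, abs_of_pos (by norm_num : (0 : ℝ) < 1 / 2)]
      exact (pow_le_pow_of_le_one (by norm_num) (by norm_num) hN).trans (by norm_num)
    have hg' := abs_le.1 hg
    generalize (2 / 3 : ℝ) ^ N = l at *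
    generalize (-(1 / 2) : ℝ) ^ N = g at *
  · linarith
  · linarith
  · nlinarith
  · have h1 : l ^ 2 ≤ (8 / 27) ^ 2 := pow_le_pow_left₀ hl0 hl 2
    have h2 : (1 + 2 * g) * (1 - g) ≤ 9 / 8 := by nlinarith [sq_nonneg (g - 1 / 4)]
    nlinarith [sq_nonneg l]

/-- The antisymmetric part of the blocks lifted from the measurement on `N` photons: that of the
identity channel for one photon, and zero otherwise. -/
noncomputable def antisymmPart (N : ℕ) : Sector N →L[ℂ] Sector N :=
  if N = 1 then (1 / 2 : ℂ) •
    (InnerProductSpace.rankOne ℂ (EuclideanSpace.single 0 1) (EuclideanSpace.single (Fin.last N) 1) -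
    InnerProductSpace.rankOne ℂ (EuclideanSpace.single (Fin.last N) 1) (EuclideanSpace.single 0 1))
  else 0

theorem norm_antisymmPart_le (N : ℕ) : ‖antisymmPart N‖ ≤ 1 := by
  rw [antisymmPart]
  split_ifs
  · rw [norm_smul]
    refine (mul_le_mul_of_nonneg_left (norm_sub_le _ _) (norm_nonneg _)).trans ?_
    simp [InnerProductSpace.norm_rankOne]
    norm_num
  · simp

theorem inner_liftBlocks {H : Type} [NormedAddCommGroup H] [InnerProductSpace ℂ H]
    (F : Fin 3 → H →L[ℂ] H) (Y : H →L[ℂ] H) (u : Fin 2 → H) :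
    ∑ a, ∑ b, inner ℂ (u a) (liftBlocks F Y a b (u b)) =
      ∑ a, ∑ b, inner ℂ (u a) (liftBlocks F 0 a b (u b)) +
        (inner ℂ (u 0) (Y (u 1)) - inner ℂ (u 1) (Y (u 0))) := by
  simp only [liftBlocks, Fin.sum_univ_two, Matrix.of_apply, Matrix.cons_val_zero,
    Matrix.cons_val_one, Matrix.cons_val', Matrix.cons_val_fin_one, add_zero, sub_zero, add_apply,
    sub_apply, inner_add_right, inner_sub_right]
  ring

/-- On one photon the measurement is the target measurement and the lifted blocks are the matrix
units `|a⟩⟨b|`, so that the form is an absolute square. -/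
theorem liftBlocks_one_nonneg (u : Fin 2 → Sector 1) :
    0 ≤ ∑ a, ∑ b, inner ℂ (u a)
      (liftBlocks (evenFill ((2 / 3) ^ 1) (clickState 1)) (antisymmPart 1) a b (u b)) := by
  have hc : ∀ (k : Fin 3) (w : Sector 1), inner ℂ (clickState 1 k) w
      = signalBar k 0 * w 0 + signalBar k 1 * w 1 := fun k w => by
    have h0 := fockCoeff_single 1 k (m := 0) (by norm_num)
    have h1 := fockCoeff_single 1 k (m := 1) le_rfl
    simp only [Nat.choose_self, Nat.choose_zero_right, Nat.cast_one, Real.sqrt_one, one_mul,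
      Nat.sub_zero, Nat.sub_self, pow_one, pow_zero, mul_one] at h0 h1
    refine (PiLp.inner_apply _ _).trans ((Fin.sum_univ_two _).trans ?_)
    simp only [clickState, fockBar, signalBar, RCLike.inner_apply, Fin.val_zero, Fin.val_one,
      Complex.conj_ofReal, h0, h1, Matrix.cons_val_zero, Matrix.cons_val_one]
    ring
  have hn : ∀ a, ((‖u a‖ ^ 2 : ℝ) : ℂ) = star (u a 0) * u a 0 + star (u a 1) * u a 1 := fun a => by
    have : inner ℂ (u a) (u a) = ((‖u a‖ ^ 2 : ℝ) : ℂ) := by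
      rw [inner_self_eq_norm_sq_to_K]
      push_cast
      rfl
    rw [← this]
    refine (PiLp.inner_apply _ _).trans ((Fin.sum_univ_two _).trans ?_)
    simp only [RCLike.inner_apply, starRingEnd_apply]
    ring
  have hs := ofReal_sqrt_three_sq
  have key : ∑ a, ∑ b, inner ℂ (u a)
      (liftBlocks (evenFill ((2 / 3) ^ 1) (clickState 1)) (antisymmPart 1) a b (u b)) =
      star (u 0 0 + u 1 1) * (u 0 0 + u 1 1) := by
    rw [inner_liftBlocks, inner_liftBlocks_evenFill _ _ u _ _ (fun k => hc k (u 0))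
      fun k => hc k (u 1)]
    push_cast at hn ⊢
    rw [hn, hn]
    simp [antisymmPart, InnerProductSpace.rankOne_apply, signalBar_zero, signalBar_one,
      signalBar_two, EuclideanSpace.inner_single_left, EuclideanSpace.inner_single_right]
    simp only [starRingEnd_apply]
    linear_combination (1 / 6 * (star (u 0 0) * u 0 0 - star (u 1 0) * u 1 0 +
      star (u 0 0) * u 1 1 + star (u 0 1) * u 1 0 + star (u 1 0) * u 0 1 +
      star (u 1 1) * u 0 0)) * hs
  rw [key]
  exact star_mul_self_nonneg _

theorem liftBlocks_fullSector_nonneg {N : ℕ} (hN : N ≠ 0) (u : Fin 2 → Sector N) :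
    0 ≤ ∑ a, ∑ b, inner ℂ (u a) (liftBlocks (fullSector N) (antisymmPart N) a b (u b)) := by
  rw [fullSector_eq_evenFill hN]
  obtain rfl | h := eq_or_ne N 1
  · exact liftBlocks_one_nonneg u
  · rw [antisymmPart, if_neg h]
    exact liftBlocks_clickState_nonneg (by omega) u

/-! ### Direct sums and compressions -/

theorem fullMeasurement_apply (k : Fin 3) (f : FockSpace) (N : ℕ+) :
    fullMeasurement k f N = fullSector N k (f N) := by
  simp only [fullMeasurement, fullSector, postProcess, sum_apply, smul_apply]
  rw [lp.coeFn_sum, Finset.sum_apply]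
  rfl

theorem sum_fullMeasurement : ∑ k, fullMeasurement k = 1 := by
  ext f N : 3
  rw [sum_apply, lp.coeFn_sum, Finset.sum_apply]
  simp only [fullMeasurement_apply]
  rw [← sum_apply, sum_fullSector]
  rfl

theorem liftBlocks_fullMeasurement_nonneg (u : Fin 2 → FockSpace) :
    0 ≤ ∑ a, ∑ b, inner ℂ (u a) (liftBlocks fullMeasurement
      (directSum (fun N => antisymmPart N) ⟨1, fun N => norm_antisymmPart_le N⟩) a b (u b)) := by
  have h : ∀ a b f (N : ℕ+), liftBlocks fullMeasurement
      (directSum (fun N => antisymmPart N) ⟨1, fun N => norm_antisymmPart_le N⟩) a b f N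
      = liftBlocks (fullSector N) (antisymmPart N) a b (f N) := by
    intro a b f N
    fin_cases a <;> fin_cases b <;>
      simp [liftBlocks, ← fullMeasurement_apply] <;> rfl
  have hs := hasSum_sum fun a (_ : a ∈ Finset.univ) => hasSum_sum fun b (_ : b ∈ Finset.univ) =>
    lp.hasSum_inner (𝕜 := ℂ) (u a) (liftBlocks fullMeasurement
      (directSum (fun N => antisymmPart N) ⟨1, fun N => norm_antisymmPart_le N⟩) a b (u b))
  refine hs.nonneg fun N => ?_
  simp only [h]
  exact liftBlocks_fullSector_nonneg N.ne_zero fun a => u a N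

section Compress

variable {H : Type} [NormedAddCommGroup H] [InnerProductSpace ℂ H] [CompleteSpace H]
  (U : Submodule ℂ H) [CompleteSpace U]

theorem inner_compress (T : H →L[ℂ] H) (x y : U) :
    inner ℂ x (compress U T y) = inner ℂ (x : H) (T y) := by
  rw [compress]
  exact ContinuousLinearMap.adjoint_inner_right U.subtypeL x (T (U.subtypeL y))

theorem sum_compress {F : Fin 3 → H →L[ℂ] H} (hF : ∑ k, F k = 1) :
    ∑ k, compress U (F k) = 1 := by
  refine ContinuousLinearMap.ext fun y => ext_inner_left ℂ fun x => ?_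
  simp only [sum_apply, inner_sum, inner_compress]
  rw [← inner_sum, ← sum_apply, hF]
  rfl

theorem liftBlocks_compress_nonneg {F : Fin 3 → H →L[ℂ] H} {Y : H →L[ℂ] H}
    (h : ∀ u : Fin 2 → H, 0 ≤ ∑ a, ∑ b, inner ℂ (u a) (liftBlocks F Y a b (u b)))
    (u : Fin 2 → U) :
    0 ≤ ∑ a, ∑ b, inner ℂ (u a)
      (liftBlocks (fun k => compress U (F k)) (compress U Y) a b (u b)) := by
  convert h fun a => (u a : H) using 4 with a _ b _
  fin_cases a <;> fin_cases b <;>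
    simp [liftBlocks, inner_compress, -Submodule.coe_inner]

end Compress

end ThreeState

theorem theorem1 :
    (∃ Λ : ThreeState.traceClass ThreeState.FockSpace →ₗ[ℂ]
        ThreeState.traceClass ThreeState.Qubit,
      ThreeState.IsSquashingMap ThreeState.fullMeasurement ThreeState.targetMeasurement Λ) ∧
    ∀ N : ℕ+, ∃ Λ : ThreeState.traceClass (ThreeState.singleClickSpace N) →ₗ[ℂ]
        ThreeState.traceClass ThreeState.Qubit,
      ThreeState.IsSquashingMap
        (fun k => ThreeState.compress (ThreeState.singleClickSpace N) (ThreeState.fullSector N k))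
        ThreeState.targetMeasurement Λ :=
  ⟨ThreeState.exists_isSquashingMap ThreeState.sum_fullMeasurement _
    ThreeState.liftBlocks_fullMeasurement_nonneg,
  fun N => ThreeState.exists_isSquashingMap
    (ThreeState.sum_compress _ (ThreeState.sum_fullSector N)) _
    (ThreeState.liftBlocks_compress_nonneg _
      (ThreeState.liftBlocks_fullSector_nonneg N.ne_zero))⟩
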